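/- Let $\mathbb{F}$ be a field and let $L$ be a Lie algebra (over any field or commutative ring $K$, of any dimension) that is graded by the multiplicative group $(\mathbb{F}^\times,\cdot)$: $L=\bigoplus_{g\in\mathbb{F}^\times}L_g$ with $[L_g,L_h]\subseteq L_{gh}$. Let $X=\{g\in\mathbb{F}^\times : L_g\neq\{0\}\}$ be its support. Suppose that $X$ is arithmetically-free, i.e. $X$ is finite and there are no $x,y\in X$ with $x\langle y\rangle\subseteq X$, where $\langle y\rangle$ is the cyclic subgroup generated by $y$. Let $\delta(X)$ be the least $\delta\in\{1,\dots,|X|\}$ such that for all $a,b_1,\dots,b_\delta\in X$ there is $I\subseteq\{1,\dots,\delta\}$ with $a\prod_{i\in I}b_i\notin X$. Then $L$ is nilpotent, and its nilpotency class $c(L)$ (the least $c\ge 0$ such that all brackets $[\dots[[x_1,x_2],x_3],\dots,x_{c+1}]$ in $L$ vanish) satisfies $$c(L)\;\le\;\delta(X)^{2^{|X|-1}-1}\;\le\;|X|^{2^{|X|-1}-1}.$$ (If $L=\{0\}$, then $X=\emptyset$ and $c(L)=0$; both bounds are then read as $0^0=1$.) -/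

import Mathlib

/-- The set of periods `{g | ∃ x ∈ X, x + ⟨g⟩ ⊆ X}` of a subset `X` of an abelian group. -/
def periodSet {G : Type*} [AddCommGroup G] (X : Set G) : Set G :=
  {g | ∃ x ∈ X, ∀ z ∈ AddSubgroup.zmultiples g, x + z ∈ X}

/-- A subset of an abelian group is arithmetically-free if it is finite and contains none of its
own periods. -/
def IsArithmeticallyFree {G : Type*} [AddCommGroup G] (X : Set G) : Prop :=
  X.Finite ∧ X ∩ periodSet X = ∅

/-- The least `d ∈ {1, …, |X|}` such that for all `a, b₁, …, b_d ∈ X` some `I ⊆ {1, …, d}`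
satisfies `a + ∑ i ∈ I, b_i ∉ X`. (Such a `d` exists if `X` is arithmetically-free and nonempty;
the value for `X = ∅` is `0`.) -/
noncomputable def arithDelta {G : Type*} [AddCommGroup G] (X : Set G) : ℕ :=
  sInf {d : ℕ | 1 ≤ d ∧ d ≤ X.ncard ∧
    ∀ a ∈ X, ∀ b : Fin d → G, (∀ i, b i ∈ X) →
      ∃ I : Finset (Fin d), a + ∑ i ∈ I, b i ∉ X}

/-- The support of a family of submodules: the set of indices of the nonzero ones. -/
def gradingSupport {ι K L : Type*} [CommRing K] [AddCommGroup L] [Module K L]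
    (𝓛 : ι → Submodule K L) : Set ι :=
  {g | 𝓛 g ≠ ⊥}

/-! Write $d=\delta(X)$, and write the grading group additively. The proof goes from a Kreknin-type
solvability bound to nilpotency.

Ordering: the finitely generated group spanned by $X$ has cyclic torsion, being inside
$\mathbb{F}^\times$, so it embeds in $\mathbb{R}/\mathbb{Z}$. Rank $X$ by representatives in
$[0,1)$. A sum that drops below one summand has wrapped around, so it drops below both
(`exists_isSumOrdering`).

Solvability: discard the degrees of $X$ one at a time in increasing rank. A suitable derived term
lies in the subalgebra generated by the components not yet discarded
(`gradedDerived_iterate_kreknin_le`). When only the last degree is left, that subalgebra is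
generated in a single degree and has class at most $d$.

Nilpotency: modulo $[[A,A],P]$ the operators $\mathrm{ad}\,a$ commute on an ideal $P$. A product of
$d$ of them can thus be reordered until a partial sum of degrees leaves $X$, and it vanishes
(`gradedLCS_le_of_sumsEscape`). So if $[A,A]$ has class $c$, then $A$ has class at most $dc+1$;
climbing the derived series costs a factor $d$ per step.

The resulting exponent fits only for $|X|\ge 4$, and only because two degrees are discarded in two
derived steps instead of three. Smaller supports, and $d=1$, are treated by hand. -/

/-! ### Graded families of submodules, brackets and generated subalgebras -/

section Families

variable {G K L : Type*} [CommRing K] [LieRing L] [LieAlgebra K L]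

/-- The family `A` vanishes in all degrees outside `X`. -/
def IsGradedSupported (X : Set G) (A : G → Submodule K L) : Prop :=
  ∀ ⦃g : G⦄ ⦃a : L⦄, a ∈ A g → g ∉ X → a = 0

theorem IsGradedSupported.mono {X : Set G} {A B : G → Submodule K L} (hA : IsGradedSupported X A)
    (h : B ≤ A) : IsGradedSupported X B := fun g _ ha hg => hA (h g ha) hg

/-- Restriction of a graded family to a set of degrees. -/
def gradedRestrict (A : G → Submodule K L) (S : Set G) : G → Submodule K L := fun g =>
  ⨆ _ : g ∈ S, A g

theorem gradedRestrict_le (A : G → Submodule K L) (S : Set G) : gradedRestrict A S ≤ A :=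
  fun _ => iSup_le fun _ => le_rfl

theorem mem_gradedRestrict {A : G → Submodule K L} {S : Set G} {g : G} {x : L} :
    x ∈ gradedRestrict A S g ↔ (g ∈ S ∧ x ∈ A g) ∨ x = 0 := by
  by_cases h : g ∈ S
  · simp only [gradedRestrict, h, iSup_pos, true_and]
    exact ⟨Or.inl, fun h => h.elim id (fun h => h ▸ zero_mem _)⟩
  · simp [gradedRestrict, h]

end Families

section GradedFamilies

variable {G K L : Type*} [AddCommGroup G] [CommRing K] [LieRing L] [LieAlgebra K L]

/-- The degree-`g` part of the bracket of two graded families of submodules. -/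
def gradedBracket (P Q : G → Submodule K L) : G → Submodule K L := fun g =>
  Submodule.span K {x | ∃ u v, u + v = g ∧ ∃ a ∈ P u, ∃ b ∈ Q v, ⁅a, b⁆ = x}

theorem lie_mem_gradedBracket {P Q : G → Submodule K L} {u v : G} {a b : L} (ha : a ∈ P u)
    (hb : b ∈ Q v) : ⁅a, b⁆ ∈ gradedBracket P Q (u + v) :=
  Submodule.subset_span ⟨u, v, rfl, a, ha, b, hb, rfl⟩

theorem gradedBracket_apply_le {P Q : G → Submodule K L} {g : G} {T : Submodule K L}
    (h : ∀ u v, u + v = g → ∀ a ∈ P u, ∀ b ∈ Q v, ⁅a, b⁆ ∈ T) : gradedBracket P Q g ≤ T := by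
  refine Submodule.span_le.2 ?_
  rintro _ ⟨u, v, huv, a, ha, b, hb, rfl⟩
  exact h u v huv a ha b hb

theorem gradedBracket_le {P Q T : G → Submodule K L}
    (h : ∀ u v, ∀ a ∈ P u, ∀ b ∈ Q v, ⁅a, b⁆ ∈ T (u + v)) : gradedBracket P Q ≤ T := fun _ =>
  gradedBracket_apply_le fun u v huv a ha b hb => huv ▸ h u v a ha b hb

theorem gradedBracket_mono {P P' Q Q' : G → Submodule K L} (hP : P ≤ P') (hQ : Q ≤ Q') :
    gradedBracket P Q ≤ gradedBracket P' Q' :=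
  gradedBracket_le fun u v _ ha _ hb => lie_mem_gradedBracket (hP u ha) (hQ v hb)

/-- A graded family of submodules is closed if it is closed under brackets of homogeneous
elements. -/
def IsGradedClosed (A : G → Submodule K L) : Prop :=
  ∀ ⦃u v : G⦄ ⦃a b : L⦄, a ∈ A u → b ∈ A v → ⁅a, b⁆ ∈ A (u + v)

/-- The derived family `[A, A]`. -/
def gradedDerived (A : G → Submodule K L) : G → Submodule K L := gradedBracket A A

theorem IsGradedClosed.gradedDerived_le {A : G → Submodule K L} (hA : IsGradedClosed A) :
    gradedDerived A ≤ A :=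
  gradedBracket_le fun _ _ _ ha _ hb => hA ha hb

theorem IsGradedClosed.gradedDerived {A : G → Submodule K L} (hA : IsGradedClosed A) :
    IsGradedClosed (gradedDerived A) := fun u v _ _ ha hb =>
  lie_mem_gradedBracket (hA.gradedDerived_le u ha) (hA.gradedDerived_le v hb)

theorem IsGradedClosed.iterate {A : G → Submodule K L} (hA : IsGradedClosed A) (n : ℕ) :
    IsGradedClosed (_root_.gradedDerived^[n] A) := by
  induction n with
  | zero => exact hA
  | succ n ih => rw [Function.iterate_succ_apply']; exact ih.gradedDerived

theorem IsGradedClosed.iterate_le {A : G → Submodule K L} (hA : IsGradedClosed A) (n : ℕ) :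
    _root_.gradedDerived^[n] A ≤ A := by
  induction n with
  | zero => exact le_rfl
  | succ n ih =>
    rw [Function.iterate_succ_apply']
    exact (hA.iterate n).gradedDerived_le.trans ih

/-- The family spanned by the brackets `[a₁, [a₂, …, [aₙ, p]…]]` with `aᵢ` in `A` and `p` in `P`. -/
def gradedLCS (A P : G → Submodule K L) : ℕ → G → Submodule K L
  | 0 => P
  | n + 1 => gradedBracket A (gradedLCS A P n)

theorem gradedLCS_mono (A : G → Submodule K L) {P Q : G → Submodule K L} (h : P ≤ Q) (n : ℕ) :
    gradedLCS A P n ≤ gradedLCS A Q n := by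
  induction n with
  | zero => exact h
  | succ n ih => exact gradedBracket_mono le_rfl ih

theorem gradedLCS_mono_left {A B : G → Submodule K L} (P : G → Submodule K L) (h : A ≤ B) (n : ℕ) :
    gradedLCS A P n ≤ gradedLCS B P n := by
  induction n with
  | zero => exact le_rfl
  | succ n ih => exact gradedBracket_mono h ih

theorem gradedLCS_add (A P : G → Submodule K L) (m n : ℕ) :
    gradedLCS A P (m + n) = gradedLCS A (gradedLCS A P m) n := by
  induction n with
  | zero => rfl
  | succ n ih => rw [← add_assoc, gradedLCS, ih, gradedLCS]

theorem gradedLCS_succ' (A P : G → Submodule K L) (n : ℕ) :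
    gradedLCS A P (n + 1) = gradedLCS A (gradedBracket A P) n := by
  rw [add_comm, gradedLCS_add]; rfl

/-- The least closed family containing `B`. -/
def gradedClosure (B : G → Submodule K L) : G → Submodule K L :=
  sInf {T | IsGradedClosed T ∧ B ≤ T}

theorem le_gradedClosure (B : G → Submodule K L) : B ≤ gradedClosure B :=
  le_sInf fun _ hT => hT.2

theorem gradedClosure_le {B T : G → Submodule K L} (hT : IsGradedClosed T) (h : B ≤ T) :
    gradedClosure B ≤ T :=
  sInf_le ⟨hT, h⟩

theorem isGradedClosed_gradedClosure (B : G → Submodule K L) :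
    IsGradedClosed (gradedClosure B) := by
  intro u v a b ha hb
  have key : ∀ {g : G} {x : L}, x ∈ gradedClosure B g ↔
      ∀ T : G → Submodule K L, IsGradedClosed T ∧ B ≤ T → x ∈ T g := by
    intro g x
    simp [gradedClosure, sInf_apply, Submodule.mem_iInf]
  rw [key] at ha hb ⊢
  exact fun T hT => hT.1 (ha T hT) (hb T hT)

/-- Bracketing with the generators alone already computes the lower central series of the generated
subalgebra. This makes every bracket have a homogeneous generator as left entry. -/
theorem gradedBracket_gradedClosure_gradedLCS_le (B : G → Submodule K L) (n : ℕ) :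
    gradedBracket (gradedClosure B) (gradedLCS B (gradedClosure B) n) ≤
      gradedLCS B (gradedClosure B) (n + 1) := by
  have anti : ∀ n, gradedLCS B (gradedClosure B) (n + 1) ≤ gradedLCS B (gradedClosure B) n := by
    intro n
    rw [gradedLCS_succ']
    exact gradedLCS_mono B (gradedBracket_le fun u v a ha b hb =>
      isGradedClosed_gradedClosure B (le_gradedClosure B u ha) hb) n
  -- The elements that advance every term by one step. By Jacobi they are closed under brackets,
  -- which even advance by two, so they contain the whole closure of `B`.
  let T : G → Submodule K L := fun g =>
    { carrier := {y | ∀ n v, ∀ z ∈ gradedLCS B (gradedClosure B) n v,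
        ⁅y, z⁆ ∈ gradedLCS B (gradedClosure B) (n + 1) (g + v)}
      add_mem' := fun {a b} ha hb n v z hz => by
        rw [add_lie]; exact add_mem (ha n v z hz) (hb n v z hz)
      zero_mem' := fun n v z hz => by rw [zero_lie]; exact zero_mem _
      smul_mem' := fun c y hy n v z hz => by
        rw [smul_lie]; exact Submodule.smul_mem _ c (hy n v z hz) }
  have hT : IsGradedClosed T := by
    intro u v a b ha hb n w z hz
    have h₁ : ⁅a, ⁅b, z⁆⁆ ∈ gradedLCS B (gradedClosure B) (n + 1 + 1) (u + v + w) := by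
      rw [add_assoc u v w]; exact ha (n + 1) (v + w) _ (hb n w z hz)
    have h₂ : ⁅b, ⁅a, z⁆⁆ ∈ gradedLCS B (gradedClosure B) (n + 1 + 1) (u + v + w) := by
      rw [add_comm u v, add_assoc v u w]; exact hb (n + 1) (u + w) _ (ha n w z hz)
    rw [lie_lie]
    exact anti (n + 1) _ (sub_mem h₁ h₂)
  have hBT : B ≤ T := fun g y hy n v z hz => lie_mem_gradedBracket hy hz
  exact gradedBracket_le fun u v a ha b hb => gradedClosure_le hT hBT u ha n v b hb

theorem gradedClosure_gradedRestrict_le {A : G → Submodule K L} (hA : IsGradedClosed A)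
    (S : Set G) : gradedClosure (gradedRestrict A S) ≤ A :=
  gradedClosure_le hA (gradedRestrict_le A S)

theorem mem_gradedClosure_gradedRestrict {A : G → Submodule K L} {S : Set G} {g : G} (hg : g ∈ S)
    {x : L} (hx : x ∈ A g) : x ∈ gradedClosure (gradedRestrict A S) g :=
  le_gradedClosure _ _ (mem_gradedRestrict.2 (Or.inl ⟨hg, hx⟩))

end GradedFamilies

/-! ### Escaping sums and iterated adjoint actions -/

section Escape

variable {G : Type*} [AddCommGroup G]

/-- Any `a ∈ X` can be moved out of `X` by adding some of `d` given elements of `X`. -/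
def SumsEscape (X : Set G) (d : ℕ) : Prop :=
  ∀ a ∈ X, ∀ b : Fin d → G, (∀ i, b i ∈ X) → ∃ I : Finset (Fin d), a + ∑ i ∈ I, b i ∉ X

theorem SumsEscape.exists_perm {X : Set G} {d : ℕ} (h : SumsEscape X d) {α : Type*} (f : α → G)
    (l : List α) (hl : l.length = d) {a : G} (ha : a ∈ X) (hf : ∀ p ∈ l, f p ∈ X) :
    ∃ l₁ l₂ : List α, l.Perm (l₁ ++ l₂) ∧ a + (l₁.map f).sum ∉ X := by
  subst hl
  obtain ⟨I, hI⟩ := h a ha (fun i => f (l.get i)) fun i => hf _ (l.get_mem i)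
  refine ⟨((List.finRange l.length).filter (· ∈ I)).map l.get,
    ((List.finRange l.length).filter (fun i => !decide (i ∈ I))).map l.get, ?_, ?_⟩
  · rw [← List.map_append]
    have h1 := (List.filter_append_perm (fun i => decide (i ∈ I)) (List.finRange l.length)).map l.get
    rw [List.map_get_finRange] at h1
    exact h1.symm
  · convert hI using 2
    rw [List.map_map, ← List.sum_toFinset _ ((List.nodup_finRange _).filter _)]
    simp [List.toFinset_filter]

end Escape

section AdFold

variable {G K L : Type*} [CommRing K] [LieRing L] [LieAlgebra K L]

/-- Iterated left bracket with the elements of a list of pairs (degree, element). -/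
def adFold : List (G × L) → L → L
  | [], x => x
  | p :: l, x => adFold l ⁅p.2, x⁆

theorem adFold_add (l : List (G × L)) (x y : L) : adFold l (x + y) = adFold l x + adFold l y := by
  induction l generalizing x y with
  | nil => rfl
  | cons p l ih => simp only [adFold, lie_add, ih]

theorem adFold_smul (l : List (G × L)) (c : K) (x : L) : adFold l (c • x) = c • adFold l x := by
  induction l generalizing x with
  | nil => rfl
  | cons p l ih => simp only [adFold, lie_smul, ih]

theorem adFold_zero (l : List (G × L)) : adFold l (0 : L) = 0 := by
  induction l with
  | nil => rfl
  | cons p l ih => simp only [adFold, lie_zero, ih]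

theorem adFold_sub (l : List (G × L)) (x y : L) : adFold l (x - y) = adFold l x - adFold l y := by
  rw [eq_sub_iff_add_eq, ← adFold_add, sub_add_cancel]

theorem adFold_append (l l' : List (G × L)) (x : L) :
    adFold (l ++ l') x = adFold l' (adFold l x) := by
  induction l generalizing x with
  | nil => rfl
  | cons p l ih => exact ih _

theorem adFold_eq_zero (l : List (G × L)) {p : G × L} (hp : p ∈ l) (h0 : p.2 = 0) (x : L) :
    adFold l x = 0 := by
  induction l generalizing x with
  | nil => cases hp
  | cons q l ih =>
    rcases List.mem_cons.1 hp with rfl | hp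
    · simp only [adFold, h0, zero_lie, adFold_zero]
    · exact ih hp _

end AdFold

/-! ### From the derived family to nilpotency -/

section Nilpotency

variable {G K L : Type*} [AddCommGroup G] [CommRing K] [LieRing L] [LieAlgebra K L]

/-- The family `P` is stable under brackets with `A`. -/
def IsGradedStable (A P : G → Submodule K L) : Prop :=
  ∀ ⦃u v : G⦄ ⦃a b : L⦄, a ∈ A u → b ∈ P v → ⁅a, b⁆ ∈ P (u + v)

theorem adFold_mem {A P : G → Submodule K L} (hP : IsGradedStable A P) (l : List (G × L))
    (hl : ∀ p ∈ l, p.2 ∈ A p.1) {g : G} {x : L} (hx : x ∈ P g) :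
    adFold l x ∈ P (g + (l.map Prod.fst).sum) := by
  induction l generalizing g x with
  | nil => simpa [adFold] using hx
  | cons p l ih =>
    have h := ih (fun q hq => hl q (List.mem_cons_of_mem _ hq)) (hP (hl p List.mem_cons_self) hx)
    rw [List.map_cons, List.sum_cons, ← add_assoc, add_comm g]
    exact h

/-- Swapping two adjacent operators changes the result by a bracket with $[a,b]$, which `hc` puts in
`T`; such swaps generate all permutations. -/
theorem adFold_sub_mem_of_perm {A P T : G → Submodule K L} (hP : IsGradedStable A P)
    (hT : IsGradedStable A T)
    (hc : ∀ ⦃u v w : G⦄ ⦃a b x : L⦄, a ∈ A u → b ∈ A v → x ∈ P w → ⁅⁅a, b⁆, x⁆ ∈ T (u + v + w))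
    {l l' : List (G × L)} (h : l.Perm l') (hl : ∀ p ∈ l, p.2 ∈ A p.1) {g : G} {x : L}
    (hx : x ∈ P g) : adFold l x - adFold l' x ∈ T (g + (l.map Prod.fst).sum) := by
  induction h generalizing g x with
  | nil => simp
  | cons p _ ih =>
    have h := ih (fun q hq => hl q (List.mem_cons_of_mem _ hq)) (hP (hl p List.mem_cons_self) hx)
    rw [List.map_cons, List.sum_cons, ← add_assoc, add_comm g]
    exact h
  | swap p q l =>
    have hp := hl p (List.mem_cons_of_mem _ List.mem_cons_self)
    have hq := hl q List.mem_cons_self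
    have h := adFold_mem hT l
      (fun r hr => hl r (List.mem_cons_of_mem _ (List.mem_cons_of_mem _ hr))) (hc hp hq hx)
    rw [lie_lie, adFold_sub] at h
    have e : g + ((q :: p :: l).map Prod.fst).sum = p.1 + q.1 + g + (l.map Prod.fst).sum := by
      simp only [List.map_cons, List.sum_cons]; abel
    rw [e]
    exact h
  | trans h₁ _ ih₁ ih₂ =>
    have h := add_mem (ih₁ hl hx) ((h₁.map Prod.fst).sum_eq ▸
      ih₂ (fun p hp => hl p (h₁.mem_iff.2 hp)) hx)
    rwa [sub_add_sub_cancel] at h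

theorem gradedLCS_le_of_adFold {A P T : G → Submodule K L} (n : ℕ)
    (h : ∀ l : List (G × L), l.length = n → (∀ p ∈ l, p.2 ∈ A p.1) → ∀ g, ∀ x ∈ P g,
      adFold l x ∈ T (g + (l.map Prod.fst).sum)) : gradedLCS A P n ≤ T := by
  induction n generalizing P with
  | zero => exact fun g x hx => by simpa [adFold] using h [] rfl (by simp) g x hx
  | succ n ih =>
    rw [gradedLCS_succ']
    refine ih fun l hl hlA g x hx => ?_
    let S : Submodule K L :=
      { carrier := {x | adFold l x ∈ T (g + (l.map Prod.fst).sum)}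
        add_mem' := fun {a b} ha hb => by
          simp only [Set.mem_ofPred_eq, adFold_add] at ha hb ⊢
          exact add_mem ha hb
        zero_mem' := by simp [adFold_zero]
        smul_mem' := fun c x hx => by
          simp only [Set.mem_ofPred_eq, adFold_smul] at hx ⊢
          exact Submodule.smul_mem _ c hx }
    refine gradedBracket_apply_le (T := S) (fun u v huv a ha b hb => ?_) hx
    have := h ((u, a) :: l) (by simp [hl]) (List.forall_mem_cons.2 ⟨ha, hlA⟩) v b hb
    rw [List.map_cons, List.sum_cons, ← add_assoc, add_comm v, huv] at this
    exact this

/-- If sums in the support `X` escape after `d` steps, then `d` brackets with `A` push a stable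
subfamily `P` into any stable `T` containing `[[A, A], P]`. -/
theorem gradedLCS_le_of_sumsEscape {X : Set G} {d : ℕ} (hd : SumsEscape X d)
    {A P T : G → Submodule K L} (hA : IsGradedClosed A) (hX : IsGradedSupported X A) (hPA : P ≤ A)
    (hP : IsGradedStable A P) (hT : IsGradedStable A T)
    (hc : ∀ ⦃u v w : G⦄ ⦃a b x : L⦄, a ∈ A u → b ∈ A v → x ∈ P w → ⁅⁅a, b⁆, x⁆ ∈ T (u + v + w)) :
    gradedLCS A P d ≤ T := by
  refine gradedLCS_le_of_adFold d fun l hl hlA g x hx => ?_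
  by_cases hg : g ∈ X
  · by_cases hlX : ∀ p ∈ l, p.1 ∈ X
    -- Put the escaping subfamily first: the reordered product is then zero, and the original one
    -- differs from it by an element of `T`.
    · obtain ⟨l₁, l₂, hperm, hout⟩ := hd.exists_perm Prod.fst l hl hg hlX
      have h := adFold_sub_mem_of_perm hP hT hc hperm hlA hx
      have h₁ : adFold l₁ x = 0 := hX (adFold_mem (P := A) hA l₁
        (fun p hp => hlA p (hperm.mem_iff.2 (List.mem_append_left _ hp))) (hPA g hx)) hout
      rwa [adFold_append, h₁, adFold_zero, sub_zero] at h
    · push Not at hlX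
      obtain ⟨p, hp, hpX⟩ := hlX
      rw [adFold_eq_zero l hp (hX (hlA p hp) hpX)]
      exact zero_mem _
  · rw [hX (hPA g hx) hg, adFold_zero]
    exact zero_mem _

/-- The lower central terms of the ideal $[A,A]$ are again ideals of $A$, by the Leibniz rule. -/
theorem isGradedStable_gradedLCS_gradedDerived {A : G → Submodule K L} (hA : IsGradedClosed A)
    (n : ℕ) : IsGradedStable A (gradedLCS (gradedDerived A) (gradedDerived A) n) := by
  induction n with
  | zero => exact fun u v a b ha hb => lie_mem_gradedBracket ha (hA.gradedDerived_le v hb)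
  | succ n ih =>
    intro u v a x ha hx
    let S : Submodule K L :=
      { carrier := {x | ⁅a, x⁆ ∈ gradedLCS (gradedDerived A) (gradedDerived A) (n + 1) (u + v)}
        add_mem' := fun {y z} hy hz => by
          simp only [Set.mem_ofPred_eq, lie_add] at hy hz ⊢
          exact add_mem hy hz
        zero_mem' := by simp
        smul_mem' := fun c x hx => by
          simp only [Set.mem_ofPred_eq, lie_smul] at hx ⊢
          exact Submodule.smul_mem _ c hx }
    refine gradedBracket_apply_le (T := S) (fun s t hst b hb c hc => ?_) hx
    change ⁅a, ⁅b, c⁆⁆ ∈ gradedBracket _ _ (u + v)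
    rw [leibniz_lie, ← hst]
    refine add_mem ?_ ?_
    · rw [← add_assoc]
      exact lie_mem_gradedBracket
        (lie_mem_gradedBracket ha (hA.gradedDerived_le s hb)) hc
    · rw [add_left_comm]
      exact lie_mem_gradedBracket hb (ih ha hc)

theorem gradedLCS_gradedDerived_le {A : G → Submodule K L} (hA : IsGradedClosed A) (n : ℕ) :
    gradedLCS (gradedDerived A) (gradedDerived A) n ≤ A := by
  induction n with
  | zero => exact hA.gradedDerived_le
  | succ n ih =>
    exact gradedBracket_le fun u v a ha b hb => hA (hA.gradedDerived_le u ha) (ih v hb)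

/-- If the derived family of `A` has nilpotency class at most `c`, then `A` has nilpotency class
at most `d * c + 1`. -/
theorem gradedLCS_eq_bot_of_gradedDerived {X : Set G} {d : ℕ} (hd : SumsEscape X d)
    {A : G → Submodule K L} (hA : IsGradedClosed A) (hX : IsGradedSupported X A) {c : ℕ}
    (hc : gradedLCS (gradedDerived A) (gradedDerived A) c = ⊥) :
    gradedLCS A A (d * c + 1) = ⊥ := by
  have step : ∀ i, gradedLCS A (gradedDerived A) (d * i) ≤
      gradedLCS (gradedDerived A) (gradedDerived A) i := by
    intro i
    induction i with
    | zero => exact le_rfl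
    | succ i ih =>
      rw [Nat.mul_succ, gradedLCS_add]
      refine (gradedLCS_mono A ih d).trans ?_
      exact gradedLCS_le_of_sumsEscape hd hA hX (gradedLCS_gradedDerived_le hA i)
        (isGradedStable_gradedLCS_gradedDerived hA i)
        (isGradedStable_gradedLCS_gradedDerived hA (i + 1))
        fun u v w a b x ha hb hx => lie_mem_gradedBracket (lie_mem_gradedBracket ha hb) hx
  rw [gradedLCS_succ']
  exact le_bot_iff.1 ((step c).trans hc.le)

/-- Tracking class plus one makes the recursion $n\mapsto dn+1$ multiplicative: $dn+2\le d(n+1)$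
once $d\ge 2$. -/
theorem exists_gradedLCS_eq_bot_of_iterate {X : Set G} {d : ℕ} (hd : SumsEscape X d) (hd2 : 2 ≤ d)
    {A : G → Submodule K L} (hA : IsGradedClosed A) (hX : IsGradedSupported X A) {c m : ℕ}
    (hc : gradedLCS (gradedDerived^[m] A) (gradedDerived^[m] A) c = ⊥) :
    ∃ n, n + 1 ≤ d ^ m * (c + 1) ∧ gradedLCS A A n = ⊥ := by
  induction m generalizing A with
  | zero => exact ⟨c, by simp, hc⟩
  | succ m ih =>
    rw [Function.iterate_succ_apply] at hc
    obtain ⟨n, hn, h⟩ := ih hA.gradedDerived (hX.mono hA.gradedDerived_le) hc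
    refine ⟨d * n + 1, ?_, gradedLCS_eq_bot_of_gradedDerived hd hA hX h⟩
    calc d * n + 1 + 1 ≤ d * n + d := by omega
      _ = d * (n + 1) := by ring
      _ ≤ d * (d ^ m * (c + 1)) := Nat.mul_le_mul_left d hn
      _ = d ^ (m + 1) * (c + 1) := by ring

end Nilpotency

/-! ### Kreknin-type elimination of degrees -/

section InitialSegment

variable {G : Type*}

/-- `Y` is an initial segment of `X` for the ranking `pos`. -/
def IsInitialSegment (X : Set G) (pos : G → ℝ) (Y : Finset G) : Prop :=
  (∀ a ∈ Y, a ∈ X) ∧ ∀ a ∈ Y, ∀ b ∈ X, pos b < pos a → b ∈ Y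

theorem IsInitialSegment.exists_max [DecidableEq G] {X : Set G} {pos : G → ℝ} {Y : Finset G}
    (hY : IsInitialSegment X pos Y) (hne : Y.Nonempty) :
    ∃ y ∈ Y, (∀ a ∈ Y, pos a ≤ pos y) ∧ IsInitialSegment X pos (Y.erase y) := by
  obtain ⟨y, hy, hmax⟩ := Y.exists_max_image pos hne
  refine ⟨y, hy, hmax, fun a ha => hY.1 a (Finset.mem_of_mem_erase ha), fun a ha b hb hlt => ?_⟩
  have haY := Finset.mem_of_mem_erase ha
  refine Finset.mem_erase.2 ⟨?_, hY.2 a haY b hb hlt⟩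
  rintro rfl
  exact absurd (hmax a haY) (not_le.2 hlt)

end InitialSegment

section Kreknin

variable {G K L : Type*} [AddCommGroup G] [CommRing K] [LieRing L] [LieAlgebra K L]

/-- An injective ranking of `X` such that a sum of two elements of `X` that lies in `X` never lies
strictly between the summands. -/
structure IsSumOrdering (X : Set G) (pos : G → ℝ) : Prop where
  injOn : Set.InjOn pos X
  lt_of_lt : ∀ u ∈ X, ∀ v ∈ X, u + v ∈ X → pos (u + v) < pos v → pos (u + v) < pos u

theorem IsInitialSegment.lt {X : Set G} {pos : G → ℝ} {Y : Finset G} (hpos : IsSumOrdering X pos)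
    (hY : IsInitialSegment X pos Y) {a b : G} (ha : a ∈ Y) (hb : b ∈ X) (hbY : b ∉ Y) :
    pos a < pos b := by
  rcases lt_trichotomy (pos a) (pos b) with h | h | h
  · exact h
  · exact absurd (hpos.injOn (hY.1 a ha) hb h ▸ ha) hbY
  · exact absurd (hY.2 a ha b hb h) hbY

/-- The family generated by the components of `A` outside `Y`. -/
def outerClosure (A : G → Submodule K L) (Y : Finset G) : G → Submodule K L :=
  gradedClosure (gradedRestrict A {g | g ∉ Y})

theorem outerClosure_le {A : G → Submodule K L} (hA : IsGradedClosed A) (Y : Finset G) :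
    outerClosure A Y ≤ A :=
  gradedClosure_gradedRestrict_le hA _

theorem mem_outerClosure {A : G → Submodule K L} {Y : Finset G} {g : G} (hg : g ∉ Y) {x : L}
    (hx : x ∈ A g) : x ∈ outerClosure A Y g :=
  mem_gradedClosure_gradedRestrict (S := {g | g ∉ Y}) hg hx

theorem isGradedClosed_outerClosure (A : G → Submodule K L) (Y : Finset G) :
    IsGradedClosed (outerClosure A Y) :=
  isGradedClosed_gradedClosure _

/-- In a bracket of degree $y=u+v$ with a generator in degree $u$, one has $u\ne y$ because $0\notin
X$, so $u\notin Y$. Then $y$ ranks below $u$, hence also below $v$, and both factors lie outside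
$Y$. -/
theorem gradedDerived_max_le [DecidableEq G] {X : Set G} (h0 : (0 : G) ∉ X) {pos : G → ℝ}
    (hpos : IsSumOrdering X pos) {Y : Finset G} (hY : IsInitialSegment X pos Y) {y : G}
    (hy : y ∈ Y) (hmax : ∀ a ∈ Y, pos a ≤ pos y) {A P : G → Submodule K L} (hA : IsGradedClosed A)
    (hX : IsGradedSupported X A) (hP : P ≤ outerClosure A (Y.erase y)) :
    gradedDerived P y ≤ outerClosure A Y y := by
  have h₁ : gradedDerived P ≤ gradedBracket (gradedRestrict A {g | g ∉ Y.erase y})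
      (outerClosure A (Y.erase y)) :=
    (gradedBracket_mono hP hP).trans (gradedBracket_gradedClosure_gradedLCS_le _ 0)
  refine (h₁ y).trans (gradedBracket_apply_le fun u v huv a ha b hb => ?_)
  have hbA := outerClosure_le hA _ v hb
  rcases mem_gradedRestrict.1 ha with ⟨huY, haA⟩ | rfl
  swap
  · rw [zero_lie]; exact zero_mem _
  by_cases hu : u ∈ X
  swap
  · rw [hX haA hu, zero_lie]; exact zero_mem _
  by_cases hv : v ∈ X
  swap
  · rw [hX hbA hv, lie_zero]; exact zero_mem _
  have huy : u ≠ y := by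
    rintro rfl
    rw [add_eq_left] at huv
    exact h0 (huv ▸ hv)
  have huY' : u ∉ Y := fun h => huY (Finset.mem_erase.2 ⟨huy, h⟩)
  have hlt : pos (v + u) < pos u := by
    rw [add_comm, huv]; exact hY.lt hpos hy hu huY'
  have hvlt := hpos.lt_of_lt v hv u hu (by rw [add_comm, huv]; exact hY.1 y hy) hlt
  rw [add_comm, huv] at hvlt
  have hvY : v ∉ Y := fun h => absurd (hmax v h) (not_le.2 hvlt)
  rw [← huv]
  exact isGradedClosed_outerClosure A Y (mem_outerClosure huY' haA) (mem_outerClosure hvY hbA)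

/-- After $m+1$ derivations the degree-$y$ component is generated from outside $Y$. The remaining
$m$ apply the induction hypothesis to that derived family, all of whose generators now qualify. -/
theorem gradedDerived_iterate_le_step [DecidableEq G] {X : Set G} (h0 : (0 : G) ∉ X) {pos : G → ℝ}
    (hpos : IsSumOrdering X pos) {Y : Finset G} (hY : IsInitialSegment X pos Y) {y : G}
    (hy : y ∈ Y) (hmax : ∀ a ∈ Y, pos a ≤ pos y) {m : ℕ}
    (ih : ∀ A : G → Submodule K L, IsGradedClosed A → IsGradedSupported X A →
      gradedDerived^[m] A ≤ outerClosure A (Y.erase y))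
    {A : G → Submodule K L} (hA : IsGradedClosed A) (hX : IsGradedSupported X A) :
    gradedDerived^[2 * m + 1] A ≤ outerClosure A Y := by
  have h₁ : (gradedDerived^[m + 1] A) y ≤ outerClosure A Y y := by
    rw [Function.iterate_succ_apply']
    exact gradedDerived_max_le h0 hpos hY hy hmax hA hX (ih A hA hX)
  rw [show 2 * m + 1 = m + (m + 1) by ring, Function.iterate_add_apply]
  refine (ih _ (hA.iterate _) (hX.mono (hA.iterate_le _))).trans
    (gradedClosure_le (isGradedClosed_outerClosure A Y) fun g x hx => ?_)
  rcases mem_gradedRestrict.1 hx with ⟨hg, hxg⟩ | rfl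
  swap
  · exact zero_mem _
  by_cases hgY : g ∈ Y
  · obtain rfl : g = y := by
      by_contra h
      exact hg (Finset.mem_erase.2 ⟨h, hgY⟩)
    exact h₁ hxg
  · exact mem_outerClosure hgY (hA.iterate_le _ g hxg)

theorem gradedDerived_le_outerClosure_of_card_eq_one {X : Set G} (h0 : (0 : G) ∉ X)
    {pos : G → ℝ} (hpos : IsSumOrdering X pos) {Y : Finset G} (hY : IsInitialSegment X pos Y)
    (hcard : Y.card = 1) {A : G → Submodule K L} (hA : IsGradedClosed A)
    (hX : IsGradedSupported X A) : gradedDerived A ≤ outerClosure A Y := by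
  classical
  obtain ⟨y, rfl⟩ := Finset.card_eq_one.1 hcard
  refine gradedDerived_iterate_le_step (m := 0) h0 hpos hY (Finset.mem_singleton_self y)
    (by simp) (fun B _ _ g x hx => mem_outerClosure (by simp) hx) hA hX

/-- The general step would need three derivations. For $Y=\{z,y\}$ with $y$ last, the only
obstruction in degree $z$ comes from factors of degree $y$ in $[A_z,A_z]$, and these act trivially
where they matter. -/
theorem gradedDerived_gradedDerived_le_outerClosure_of_card_eq_two {X : Set G}
    (h0 : (0 : G) ∉ X) {pos : G → ℝ} (hpos : IsSumOrdering X pos) {Y : Finset G}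
    (hY : IsInitialSegment X pos Y) (hcard : Y.card = 2) {A : G → Submodule K L}
    (hA : IsGradedClosed A) (hX : IsGradedSupported X A) :
    gradedDerived (gradedDerived A) ≤ outerClosure A Y := by
  classical
  obtain ⟨y, hy, hmax, hY'⟩ := hY.exists_max (Finset.card_pos.1 (by omega))
  have hcard' : (Y.erase y).card = 1 := by rw [Finset.card_erase_of_mem hy, hcard]
  have hD := gradedDerived_le_outerClosure_of_card_eq_one h0 hpos hY' hcard' hA hX
  obtain ⟨z, hz⟩ := Finset.card_eq_one.1 hcard'
  have hzY : z ∈ Y := Finset.mem_of_mem_erase (hz ▸ Finset.mem_singleton_self z)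
  have hmem : ∀ g ∈ Y, g = y ∨ g = z := fun g hg => by
    by_cases h : g = y
    · exact Or.inl h
    · exact Or.inr (Finset.mem_singleton.1 (hz ▸ Finset.mem_erase.2 ⟨h, hg⟩))
  have hX' : ∀ {g : G} {a : L}, a ∈ A g → a ≠ 0 → g ∈ X := fun ha hne => by
    by_contra h
    exact hne (hX ha h)
  -- modulo the outer closure, brackets in degree `u` kill `A v` when `u + v = z`
  have key : ∀ {u v : G}, u + v = z → v ∈ X → ∀ a ∈ gradedDerived A u,
      ∃ c ∈ outerClosure A Y u, ∀ b ∈ A v, ⁅a - c, b⁆ = 0 := by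
    intro u v huv hv a ha
    by_cases huY : u ∈ Y
    swap
    · exact ⟨a, mem_outerClosure huY (hA.gradedDerived_le u ha), by simp⟩
    have huz : u ≠ z := by
      rintro rfl
      rw [add_eq_left] at huv
      exact h0 (huv ▸ hv)
    obtain rfl : u = y := (hmem u huY).resolve_right huz
    let N : Submodule K L :=
      { carrier := {x | ∀ b ∈ A v, ⁅x, b⁆ = 0}
        add_mem' := fun hx hy b hb => by rw [add_lie, hx b hb, hy b hb, add_zero]
        zero_mem' := fun b _ => zero_lie b
        smul_mem' := fun c x hx b hb => by rw [smul_lie, hx b hb, smul_zero] }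
    suffices h : gradedDerived A u ≤ outerClosure A Y u ⊔ N by
      obtain ⟨c, hc, n, hn, rfl⟩ := Submodule.mem_sup.1 (h ha)
      exact ⟨c, hc, fun b hb => by rw [add_sub_cancel_left]; exact hn b hb⟩
    refine gradedBracket_apply_le fun i j hij p hp q hq => ?_
    by_cases hp0 : p = 0
    · rw [hp0, zero_lie]; exact zero_mem _
    by_cases hq0 : q = 0
    · rw [hq0, lie_zero]; exact zero_mem _
    have hi := hX' hp hp0
    have hj := hX' hq hq0
    have hiu : i ≠ u := by
      rintro rfl
      rw [add_eq_left] at hij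
      exact h0 (hij ▸ hj)
    have hju : j ≠ u := by
      rintro rfl
      rw [add_eq_right] at hij
      exact h0 (hij ▸ hi)
    have huX := hY.1 u huY
    by_cases hiY : i ∈ Y
    · have hjY : j ∈ Y := by
        by_contra hjY
        have := hpos.lt_of_lt i hi j hj (hij ▸ huX) (hij ▸ hY.lt hpos huY hj hjY)
        rw [hij] at this
        exact absurd (hmax i hiY) (not_le.2 this)
      obtain rfl : i = z := (hmem i hiY).resolve_left hiu
      obtain rfl : j = i := (hmem j hjY).resolve_left hju
      -- Here $y=2z$ and $y+v=z$, so $v=-z$. Thus $[A_z,A_v]$ has degree $0\notin X$ and vanishes,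
      -- and Jacobi kills $[[p,q],b]$.
      refine Submodule.mem_sup_right fun b hb => ?_
      have hjv : j + v = 0 := by
        rw [← hij, add_assoc, add_eq_left] at huv
        exact huv
      have hkill : ∀ x ∈ A j, ⁅x, b⁆ = 0 := fun x hx =>
        hX (hA hx hb) (by rw [hjv]; exact h0)
      rw [lie_lie, hkill p hp, hkill q hq, lie_zero, lie_zero, sub_zero]
    · have hjY : j ∉ Y := by
        intro hjY
        have := hpos.lt_of_lt j hj i hi (by rw [add_comm, hij]; exact huX)
          (by rw [add_comm, hij]; exact hY.lt hpos huY hi hiY)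
        rw [add_comm, hij] at this
        exact absurd (hmax j hjY) (not_le.2 this)
      refine Submodule.mem_sup_left ?_
      rw [← hij]
      exact isGradedClosed_outerClosure A Y (mem_outerClosure hiY hp) (mem_outerClosure hjY hq)
  intro g x hx
  by_cases hgY : g ∈ Y
  swap
  · exact mem_outerClosure hgY (hA.iterate_le 2 g hx)
  rcases hmem g hgY with rfl | rfl
  · exact gradedDerived_max_le h0 hpos hY hy hmax hA hX hD hx
  refine gradedBracket_apply_le (fun u v huv a ha b hb => ?_) hx
  have haA := hA.gradedDerived_le u ha
  have hbA := hA.gradedDerived_le v hb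
  by_cases ha0 : a = 0
  · rw [ha0, zero_lie]; exact zero_mem _
  by_cases hb0 : b = 0
  · rw [hb0, lie_zero]; exact zero_mem _
  obtain ⟨c, hc, hac⟩ := key huv (hX' hbA hb0) a ha
  obtain ⟨d, hd, hbd⟩ := key (by rwa [add_comm]) (hX' haA ha0) b hb
  -- Replace the two factors in turn by representatives in the outer closure.
  have h₁ : ⁅a, b⁆ = ⁅c, b⁆ := sub_eq_zero.1 (by rw [← sub_lie, hac b hbA])
  have h₂ : ⁅b, c⁆ = ⁅d, c⁆ :=
    sub_eq_zero.1 (by rw [← sub_lie, hbd c (outerClosure_le hA Y u hc)])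
  rw [h₁, ← lie_skew, h₂, lie_skew, ← huv]
  exact isGradedClosed_outerClosure A Y hc hd

/-- The exponents `0, 1, 2, 5, 11, …` in the solvability bound. -/
def kreknin : ℕ → ℕ
  | 0 => 0
  | 1 => 1
  | 2 => 2
  | n + 3 => 2 * kreknin (n + 2) + 1

theorem kreknin_add_two (n : ℕ) : kreknin (n + 2) + 1 = 3 * 2 ^ n := by
  induction n with
  | zero => rfl
  | succ n ih => rw [kreknin, pow_succ]; omega

theorem gradedDerived_iterate_kreknin_le {X : Set G} (h0 : (0 : G) ∉ X) {pos : G → ℝ}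
    (hpos : IsSumOrdering X pos) (k : ℕ) {Y : Finset G} (hY : IsInitialSegment X pos Y)
    (hcard : Y.card = k) {A : G → Submodule K L} (hA : IsGradedClosed A)
    (hX : IsGradedSupported X A) : gradedDerived^[kreknin k] A ≤ outerClosure A Y := by
  classical
  induction k using kreknin.induct generalizing Y A with
  | case1 =>
    obtain rfl := Finset.card_eq_zero.1 hcard
    exact fun g x hx => mem_outerClosure (by simp) hx
  | case2 => exact gradedDerived_le_outerClosure_of_card_eq_one h0 hpos hY hcard hA hX
  | case3 => exact gradedDerived_gradedDerived_le_outerClosure_of_card_eq_two h0 hpos hY hcard hA hX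
  | case4 n ih =>
    obtain ⟨y, hy, hmax, hY'⟩ := hY.exists_max (Finset.card_pos.1 (by omega))
    refine gradedDerived_iterate_le_step h0 hpos hY hy hmax (fun B hB hBX => ih hY' ?_ hB hBX) hA hX
    rw [Finset.card_erase_of_mem hy, hcard]
    rfl

/-- A closed family generated in a single degree has nilpotency class at most `d`. -/
theorem gradedLCS_gradedClosure_eq_bot {X : Set G} {d : ℕ} (hd : SumsEscape X d) {x : G}
    (hx : x ∈ X) {B : G → Submodule K L} (hB : IsGradedSupported {x} B)
    (hX : IsGradedSupported X (gradedClosure B)) :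
    gradedLCS (gradedClosure B) (gradedClosure B) d = ⊥ := by
  have h₁ : ∀ n, gradedLCS (gradedClosure B) (gradedClosure B) n ≤
      gradedLCS B (gradedClosure B) n := by
    intro n
    induction n with
    | zero => exact le_rfl
    | succ n ih =>
      exact (gradedBracket_mono le_rfl ih).trans (gradedBracket_gradedClosure_gradedLCS_le B n)
  refine le_bot_iff.1 ((h₁ d).trans (gradedLCS_le_of_adFold d fun l hl hlB g y hy => ?_))
  rw [Pi.bot_apply, Submodule.mem_bot]
  by_cases hg : g ∈ X
  swap
  · rw [hX hy hg, adFold_zero]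
  by_cases hlx : ∀ p ∈ l, p.1 ∈ ({x} : Set G)
  swap
  · push Not at hlx
    obtain ⟨p, hp, hpx⟩ := hlx
    exact adFold_eq_zero l hp (hB (hlB p hp) hpx) y
  have hst : IsGradedStable B (gradedClosure B) := fun u v a b ha hb =>
    isGradedClosed_gradedClosure B (le_gradedClosure B u ha) hb
  have hlX : ∀ p ∈ l, p.1 ∈ X := fun p hp => by
    rw [show p.1 = x from hlx p hp]; exact hx
  obtain ⟨l₁, l₂, hperm, hout⟩ := hd.exists_perm Prod.fst l hl hg hlX
  -- All degrees equal `x`, so partial sums depend on length only: a prefix of the original list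
  -- already escapes and no reordering is needed.
  have hsum : ((l.take l₁.length).map Prod.fst).sum = (l₁.map Prod.fst).sum := by
    have h₂ : ∀ l' : List (G × L), (∀ p ∈ l', p ∈ l) →
        (l'.map Prod.fst).sum = l'.length • x := by
      intro l' hl'
      rw [List.sum_eq_card_nsmul (l'.map Prod.fst) x, List.length_map]
      intro b hb
      obtain ⟨p, hp, rfl⟩ := List.mem_map.1 hb
      exact hlx p (hl' p hp)
    rw [h₂ _ fun p hp => List.mem_of_mem_take hp,
      h₂ l₁ fun p hp => hperm.mem_iff.2 (List.mem_append_left _ hp), List.length_take,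
      min_eq_left (by rw [hperm.length_eq, List.length_append]; omega)]
  rw [← List.take_append_drop l₁.length l, adFold_append,
    hX (adFold_mem hst _ (fun p hp => hlB p (List.mem_of_mem_take hp)) hy) (hsum ▸ hout),
    adFold_zero]

/-- Nilpotency of a closed family with at least four degrees in its support. -/
theorem exists_gradedLCS_eq_bot_of_four_le_card {X : Finset G} (h0 : (0 : G) ∉ X) {pos : G → ℝ}
    (hpos : IsSumOrdering (X : Set G) pos) {d : ℕ} (hd : SumsEscape (X : Set G) d) (hd2 : 2 ≤ d)
    (hcard : 4 ≤ X.card) {A : G → Submodule K L} (hA : IsGradedClosed A)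
    (hX : IsGradedSupported (X : Set G) A) :
    ∃ n ≤ d ^ (2 ^ (X.card - 1) - 1), gradedLCS A A n = ⊥ := by
  classical
  have hXX : IsInitialSegment (X : Set G) pos X :=
    ⟨fun a ha => ha, fun _ _ b hb _ => hb⟩
  obtain ⟨x, hx, -, hY⟩ := hXX.exists_max (Finset.card_pos.1 (by omega))
  obtain ⟨k, hk⟩ : ∃ k, X.card = k + 4 := ⟨X.card - 4, by omega⟩
  have hYcard : (X.erase x).card = (k + 1) + 2 := by rw [Finset.card_erase_of_mem hx, hk]; rfl
  have hle := gradedDerived_iterate_kreknin_le h0 hpos _ hY hYcard hA hX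
  set m := kreknin (k + 1 + 2) with hm
  have hB : IsGradedSupported {x} (gradedRestrict A {g | g ∉ X.erase x}) := by
    intro g a ha hg
    rcases mem_gradedRestrict.1 ha with ⟨hgY, ha⟩ | ha
    · exact hX ha fun h => hgY (Finset.mem_erase.2 ⟨hg, h⟩)
    · exact ha
  have hc := gradedLCS_gradedClosure_eq_bot hd hx hB (hX.mono (outerClosure_le hA _))
  have hc' : gradedLCS (gradedDerived^[m] A) (gradedDerived^[m] A) d = ⊥ :=
    le_bot_iff.1 (((gradedLCS_mono _ hle d).trans (gradedLCS_mono_left _ hle d)).trans hc.le)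
  obtain ⟨n, hn, h⟩ := exists_gradedLCS_eq_bot_of_iterate hd hd2 hA hX hc'
  refine ⟨n, ?_, h⟩
  have hm' : m + 1 = 3 * 2 ^ (k + 1) := kreknin_add_two (k + 1)
  have hpow : 1 ≤ 2 ^ k := Nat.one_le_two_pow
  -- With $|X|=k+4$ this reads $3\cdot 2^{k+1}+1\le 4\cdot 2^{k+1}-1$, an equality for $k=0$.
  have hexp : m + 2 ≤ 2 ^ (X.card - 1) - 1 := by
    rw [hk, show k + 4 - 1 = k + 3 by omega]
    simp only [pow_succ] at hm' ⊢
    omega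
  calc n ≤ d ^ m * (d + 1) := by omega
    _ ≤ d ^ m * d ^ 2 := Nat.mul_le_mul_left _ (by nlinarith)
    _ = d ^ (m + 2) := (pow_add d m 2).symm
    _ ≤ d ^ (2 ^ (X.card - 1) - 1) := Nat.pow_le_pow_right (by omega) hexp

end Kreknin

/-! ### Combinatorics of arithmetically-free sets -/

section ArithmeticallyFree

variable {G : Type*} [AddCommGroup G]

theorem IsArithmeticallyFree.exists_add_zsmul_notMem {X : Set G} (hX : IsArithmeticallyFree X)
    {x y : G} (hx : x ∈ X) (hy : y ∈ X) : ∃ n : ℤ, x + n • y ∉ X := by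
  by_contra! h
  have : y ∈ X ∩ periodSet X := by
    refine ⟨hy, x, hx, fun z hz => ?_⟩
    obtain ⟨n, rfl⟩ := AddSubgroup.mem_zmultiples_iff.1 hz
    exact h n
  rw [hX.2] at this
  exact this

theorem IsArithmeticallyFree.zero_notMem {X : Set G} (hX : IsArithmeticallyFree X) :
    (0 : G) ∉ X := fun h => by
  obtain ⟨n, hn⟩ := hX.exists_add_zsmul_notMem h h
  rw [smul_zero, add_zero] at hn
  exact hn h

/-- By finiteness, $P+y\subseteq P$ forces $P+y=P$, so $P$ would contain a full coset of $\langle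
y\rangle$. -/
theorem IsArithmeticallyFree.not_forall_add_mem {X : Set G} (hX : IsArithmeticallyFree X)
    {P : Finset G} (hP : ∀ p ∈ P, p ∈ X) (hne : P.Nonempty) {y : G} (hy : y ∈ X) :
    ¬ ∀ p ∈ P, p + y ∈ P := by
  classical
  intro h
  have himg : P.image (· + y) = P :=
    Finset.eq_of_subset_of_card_le (Finset.image_subset_iff.2 h)
      (Finset.card_image_of_injective P (add_left_injective y)).ge
  have hneg : ∀ p ∈ P, p - y ∈ P := by
    intro p hp
    rw [← himg] at hp
    obtain ⟨q, hq, rfl⟩ := Finset.mem_image.1 hp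
    simpa using hq
  obtain ⟨x, hx⟩ := hne
  have key : ∀ n : ℤ, x + n • y ∈ P := by
    intro n
    induction n using Int.induction_on with
    | zero => simpa using hx
    | succ n ih =>
      rw [add_smul, one_smul, ← add_assoc]
      exact h _ ih
    | pred n ih =>
      rw [sub_smul, one_smul, ← add_sub_assoc]
      exact hneg _ ih
  obtain ⟨n, hn⟩ := hX.exists_add_zsmul_notMem (hP x hx) hy
  exact hn (hP _ (key n))

/-- If nothing escapes, each new $b_k$ strictly enlarges the set of partial sums, giving $|X|+1$
elements inside $X$. -/
theorem IsArithmeticallyFree.sumsEscape_ncard {X : Set G} (hX : IsArithmeticallyFree X) :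
    SumsEscape X X.ncard := by
  classical
  intro a ha b hb
  by_contra! hI
  -- the sets of partial sums strictly increase
  let Q : ℕ → Finset G := fun k =>
    ((Finset.univ.filter fun i : Fin X.ncard => (i : ℕ) < k).powerset).image
      fun I => a + ∑ i ∈ I, b i
  have hQ : ∀ k, ∀ q ∈ Q k, q ∈ X := by
    intro k q hq
    obtain ⟨I, -, rfl⟩ := Finset.mem_image.1 hq
    exact hI I
  have hcard : ∀ k, k ≤ X.ncard → k + 1 ≤ (Q k).card := by
    intro k
    induction k with
    | zero =>
      exact fun _ => Finset.card_pos.2 ⟨a, Finset.mem_image.2 ⟨∅, by simp, by simp⟩⟩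
    | succ k ih =>
      intro hk
      refine (Nat.succ_le_succ (ih (by omega))).trans (Finset.card_lt_card ?_)
      have hsub : Q k ⊆ Q (k + 1) := by
        refine Finset.image_subset_image (Finset.powerset_mono.2 fun i hi => ?_)
        simp only [Finset.mem_filter, Finset.mem_univ, true_and] at hi ⊢
        omega
      refine hsub.ssubset_of_ne fun heq => ?_
      have hne : (Q k).Nonempty := ⟨a, Finset.mem_image.2 ⟨∅, by simp, by simp⟩⟩
      refine hX.not_forall_add_mem (hQ k) hne (hb ⟨k, hk⟩) fun p hp => ?_
      obtain ⟨I, hI, rfl⟩ := Finset.mem_image.1 hp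
      rw [heq]
      have hIlt : ∀ i ∈ I, (i : ℕ) < k := fun i hi => by
        simpa using Finset.mem_powerset.1 hI hi
      refine Finset.mem_image.2 ⟨insert ⟨k, hk⟩ I, ?_, ?_⟩
      · refine Finset.mem_powerset.2 fun i hi => ?_
        rcases Finset.mem_insert.1 hi with rfl | hi
        · simp
        · have := hIlt i hi
          simp only [Finset.mem_filter, Finset.mem_univ, true_and]
          omega
      · have hnot : (⟨k, hk⟩ : Fin X.ncard) ∉ I := fun h => lt_irrefl _ (hIlt _ h)
        rw [Finset.sum_insert hnot, add_assoc, add_comm (b _)]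
  have h₁ := hcard X.ncard le_rfl
  have h₂ : (Q X.ncard).card ≤ X.ncard := by
    rw [← Set.ncard_coe_finset]
    exact Set.ncard_le_ncard (fun q hq => hQ _ q hq) hX.1
  omega

theorem IsArithmeticallyFree.arithDelta_spec {X : Set G} (hX : IsArithmeticallyFree X)
    (hne : X.Nonempty) :
    1 ≤ arithDelta X ∧ arithDelta X ≤ X.ncard ∧ SumsEscape X (arithDelta X) :=
  Nat.sInf_mem (s := {d : ℕ | 1 ≤ d ∧ d ≤ X.ncard ∧ SumsEscape X d})
    ⟨X.ncard, (Set.ncard_pos hX.1).2 hne, le_rfl, hX.sumsEscape_ncard⟩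

theorem IsArithmeticallyFree.add_add_notMem {X : Finset G}
    (hX : IsArithmeticallyFree (X : Set G)) (hcard : X.card ≤ 3) {a b : G} (ha : a ∈ X)
    (hb : b ∈ X) (hab : a + b ∈ X) (hne : a ≠ b) : a + (a + b) ∉ X := by
  classical
  intro h
  have h0 : (0 : G) ∉ X := hX.zero_notMem
  have ha0 : a ≠ 0 := fun h => h0 (h ▸ ha)
  have hb0 : b ≠ 0 := fun h => h0 (h ▸ hb)
  have heq : ({a, b, a + b} : Finset G) = X := by
    refine Finset.eq_of_subset_of_card_le (by simp [Finset.insert_subset_iff, ha, hb, hab]) ?_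
    rw [Finset.card_eq_three.2 ⟨a, b, a + b, hne, by simpa using hb0, by simpa using ha0, rfl⟩]
    exact hcard
  rw [← heq] at h
  simp only [Finset.mem_insert, Finset.mem_singleton, add_eq_left, add_eq_right] at h
  rcases h with h | h | h
  · exact h0 (h ▸ hab)
  · rw [← add_assoc, add_eq_right] at h
    refine hX.not_forall_add_mem (P := {b, a + b}) ?_ (by simp) ha ?_
    · simp [hb, hab]
    · intro p hp
      simp only [Finset.mem_insert, Finset.mem_singleton] at hp ⊢
      rcases hp with rfl | rfl
      · exact Or.inr (add_comm _ _)
      · left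
        rw [add_right_comm, h, zero_add]
  · exact ha0 h

end ArithmeticallyFree

/-! ### Supports of at most three degrees, and $\delta=1$ -/

section SmallSupport

variable {G K L : Type*} [AddCommGroup G] [CommRing K] [LieRing L] [LieAlgebra K L]

theorem gradedLCS_one_eq_bot {X : Set G} (hd : SumsEscape X 1) {A : G → Submodule K L}
    (hA : IsGradedClosed A) (hX : IsGradedSupported X A) : gradedLCS A A 1 = ⊥ := by
  refine le_bot_iff.1 (gradedBracket_le fun u v a ha b hb => ?_)
  rw [Pi.bot_apply, Submodule.mem_bot]
  by_cases hu : u ∈ X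
  swap
  · rw [hX ha hu, zero_lie]
  by_cases hv : v ∈ X
  swap
  · rw [hX hb hv, lie_zero]
  obtain ⟨I, hI⟩ := hd u hu (fun _ => v) fun _ => hv
  rcases I.eq_empty_or_nonempty with rfl | hne
  · simp [hu] at hI
  · obtain rfl : I = {0} := by
      rw [Finset.eq_singleton_iff_nonempty_unique_mem]
      exact ⟨hne, fun x _ => Subsingleton.elim _ _⟩
    exact hX (hA ha hb) (by simpa using hI)

/-- A nonzero $[p,q]$ forces $X=\{a,b,a+b\}$, while $2a+b$ and $a+2b$ lie outside $X$. This settles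
$c=a$ and $c=b$ at once, and $c=a+b$ through Leibniz. -/
theorem lie_lie_eq_zero_of_ne {X : Finset G} (hX : IsArithmeticallyFree (X : Set G))
    (hcard : X.card ≤ 3) {A : G → Submodule K L} (hA : IsGradedClosed A)
    (hAX : IsGradedSupported (X : Set G) A) {a b c : G} (hne : a ≠ b) {p q r : L} (hp : p ∈ A a)
    (hq : q ∈ A b) (hr : r ∈ A c) : ⁅r, ⁅p, q⁆⁆ = 0 := by
  classical
  by_cases ha : a ∈ X
  swap
  · rw [hAX hp ha, zero_lie, lie_zero]
  by_cases hb : b ∈ X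
  swap
  · rw [hAX hq hb, lie_zero, lie_zero]
  by_cases hc : c ∈ X
  swap
  · rw [hAX hr hc, zero_lie]
  by_cases hab : a + b ∈ X
  swap
  · rw [hAX (hA hp hq) hab, lie_zero]
  have ha' : a + (a + b) ∉ X := hX.add_add_notMem hcard ha hb hab hne
  have hb' : b + (a + b) ∉ X := by
    rw [add_comm a b] at hab ⊢
    exact hX.add_add_notMem hcard hb ha hab hne.symm
  have h0 : (0 : G) ∉ X := hX.zero_notMem
  have heq : ({a, b, a + b} : Finset G) = X := by
    refine Finset.eq_of_subset_of_card_le (by simp [Finset.insert_subset_iff, ha, hb, hab]) ?_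
    have ha0 : a ≠ 0 := fun h => h0 (h ▸ ha)
    have hb0 : b ≠ 0 := fun h => h0 (h ▸ hb)
    rw [Finset.card_eq_three.2 ⟨a, b, a + b, hne, by simpa using hb0, by simpa using ha0, rfl⟩]
    exact hcard
  rw [← heq] at hc
  simp only [Finset.mem_insert, Finset.mem_singleton] at hc
  rcases hc with rfl | rfl | rfl
  · exact hAX (hA hr (hA hp hq)) ha'
  · exact hAX (hA hr (hA hp hq)) hb'
  · have h₁ : ⁅r, p⁆ = 0 := hAX (hA hr hp) (by rwa [add_comm _ a])
    have h₂ : ⁅r, q⁆ = 0 := hAX (hA hr hq) (by rwa [add_comm _ b])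
    rw [leibniz_lie, h₁, h₂, zero_lie, lie_zero, add_zero]

theorem lie_lie_eq_zero_of_ne_left {X : Finset G} (hX : IsArithmeticallyFree (X : Set G))
    (hcard : X.card ≤ 3) {A : G → Submodule K L} (hA : IsGradedClosed A)
    (hAX : IsGradedSupported (X : Set G) A) {a c : G} (hne : c ≠ a) {p q r : L} (hp : p ∈ A a)
    (hq : q ∈ A a) (hr : r ∈ A c) : ⁅r, ⁅p, q⁆⁆ = 0 := by
  have h₁ := lie_lie_eq_zero_of_ne hX hcard hA hAX hne hr hp hq
  have h₂ := lie_lie_eq_zero_of_ne hX hcard hA hAX hne hr hq hp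
  rw [leibniz_lie, h₂, ← lie_skew, h₁, neg_zero, add_zero]

theorem gradedLCS_three_eq_bot {X : Finset G} (hX : IsArithmeticallyFree (X : Set G))
    (hcard : X.card ≤ 3) {A : G → Submodule K L} (hA : IsGradedClosed A)
    (hAX : IsGradedSupported (X : Set G) A) : gradedLCS A A 3 = ⊥ := by
  refine le_bot_iff.1 (gradedLCS_le_of_adFold 3 fun l hl hlA g x hx => ?_)
  rw [Pi.bot_apply, Submodule.mem_bot]
  obtain ⟨⟨u, p⟩, ⟨v, q⟩, ⟨w, r⟩, rfl⟩ := List.length_eq_three.1 hl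
  have hp : p ∈ A u := hlA (u, p) (by simp)
  have hq : q ∈ A v := hlA (v, q) (by simp)
  have hr : r ∈ A w := hlA (w, r) (by simp)
  change ⁅r, ⁅q, ⁅p, x⁆⁆⁆ = 0
  by_cases hu : u = g
  swap
  · rw [lie_lie_eq_zero_of_ne hX hcard hA hAX hu hp hx hq, lie_zero]
  subst hu
  by_cases hv : v = u
  swap
  · rw [lie_lie_eq_zero_of_ne_left hX hcard hA hAX hv hp hx hq, lie_zero]
  subst hv
  by_cases hvX : v ∈ X
  swap
  · rw [hAX hp hvX, zero_lie, lie_zero, lie_zero]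
  -- Only equal degrees $v$ survive; then `q` and $[p,x]$ have the distinct degrees $v$ and $2v$.
  refine lie_lie_eq_zero_of_ne hX hcard hA hAX (fun h => ?_) hq (hA hp hx) hr
  rw [left_eq_add] at h
  exact hX.zero_notMem (h ▸ hvX)

theorem gradedLCS_two_eq_bot {X : Finset G} (hX : IsArithmeticallyFree (X : Set G))
    (hcard : X.card ≤ 2) {A : G → Submodule K L} (hA : IsGradedClosed A)
    (hAX : IsGradedSupported (X : Set G) A) : gradedLCS A A 2 = ⊥ := by
  classical
  have hcard3 : X.card ≤ 3 := by omega
  refine le_bot_iff.1 (gradedLCS_le_of_adFold 2 fun l hl hlA g x hx => ?_)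
  rw [Pi.bot_apply, Submodule.mem_bot]
  obtain ⟨⟨u, p⟩, ⟨v, q⟩, rfl⟩ := List.length_eq_two.1 hl
  have hp : p ∈ A u := hlA (u, p) (by simp)
  have hq : q ∈ A v := hlA (v, q) (by simp)
  change ⁅q, ⁅p, x⁆⁆ = 0
  by_cases hu : u = g
  swap
  · exact lie_lie_eq_zero_of_ne hX hcard3 hA hAX hu hp hx hq
  subst hu
  by_cases hv : v = u
  swap
  · exact lie_lie_eq_zero_of_ne_left hX hcard3 hA hAX hv hp hx hq
  subst hv
  by_cases h₁ : v ∈ X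
  swap
  · rw [hAX hp h₁, zero_lie, lie_zero]
  by_cases h₂ : v + v ∈ X
  swap
  · rw [hAX (hA hp hx) h₂, lie_zero]
  refine hAX (hA hq (hA hp hx)) fun h₃ => ?_
  have h0 : (0 : G) ∉ X := hX.zero_notMem
  have hv0 : v ≠ 0 := fun h => h0 (h ▸ h₁)
  have hvv : v + v ≠ 0 := fun h => h0 (h ▸ h₂)
  -- A nonzero bracket needs $v,2v,3v\in X$, three distinct degrees.
  have hthree : ({v, v + v, v + (v + v)} : Finset G).card = 3 :=
    Finset.card_eq_three.2 ⟨v, v + v, v + (v + v), by simpa using hv0, by simpa using hvv,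
      by simpa using hv0, rfl⟩
  have hsub : ({v, v + v, v + (v + v)} : Finset G) ⊆ X := by
    simp [Finset.insert_subset_iff, h₁, h₂, Finset.mem_coe.1 h₃]
  have := Finset.card_le_card hsub
  omega

end SmallSupport

/-! ### Embedding into the circle and the ordering -/

section Ordering

open Polynomial in
theorem exists_injective_addMonoidHom_unitAddCircle (n N : ℕ) [NeZero N] :
    ∃ ψ : (Fin n →₀ ℤ) × ZMod N →+ UnitAddCircle, Function.Injective ψ := by
  -- The free generators go to $t,t^2,\dots,t^n$. Starting at exponent $1$ keeps the constant term
  -- free for the integer ambiguity modulo $\mathbb{Z}$; multiplying by $N$ removes the torsion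
  -- part.
  obtain ⟨t, ht⟩ : ∃ t : ℝ, Transcendental ℤ t := ⟨_, transcendental_liouvilleNumber le_rfl⟩
  let φ : (Fin n →₀ ℤ) →+ ℝ := AddMonoidHom.mk' (fun v => ∑ i, (v i : ℝ) * t ^ ((i : ℕ) + 1))
    fun v w => by simp [add_mul, Finset.sum_add_distrib]
  let ψ : (Fin n →₀ ℤ) × ZMod N →+ UnitAddCircle :=
    ((QuotientAddGroup.mk' (AddSubgroup.zmultiples (1 : ℝ))).comp φ).coprod ZMod.toAddCircle
  refine ⟨ψ, (injective_iff_map_eq_zero ψ).2 ?_⟩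
  rintro ⟨v, k⟩ h
  have h : ((φ v : ℝ) : UnitAddCircle) + ZMod.toAddCircle k = 0 := h
  have hN : ((N • φ v : ℝ) : UnitAddCircle) = 0 := by
    have h' := congrArg (N • ·) h
    simp only [smul_add, smul_zero, ← map_nsmul] at h'
    rwa [nsmul_eq_mul N k, ZMod.natCast_self, zero_mul, map_zero, add_zero,
      ← AddCircle.coe_nsmul] at h'
  obtain ⟨m, hm⟩ := (AddCircle.coe_eq_zero_iff 1).1 hN
  have hpoly : (N : ℤ[X]) * ∑ i, C (v i) * X ^ ((i : ℕ) + 1) - C m = 0 := by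
    by_contra hne
    refine ht ⟨_, hne, ?_⟩
    have hm' : (m : ℝ) = N * ∑ i, (v i : ℝ) * t ^ ((i : ℕ) + 1) := by
      simpa [φ] using hm
    simp [hm']
  have hv : v = 0 := by
    ext j
    have hj := congrArg (fun p => p.coeff ((j : ℕ) + 1)) hpoly
    simp only [coeff_sub, ← C_eq_natCast, coeff_C_mul, finsetSum_coeff, coeff_X_pow,
      coeff_C_succ, sub_zero, coeff_zero] at hj
    rw [Finset.sum_eq_single j (fun i _ hij => by
      rw [if_neg fun h => hij (Fin.ext (by omega)), mul_zero]) (by simp)] at hj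
    simpa [NeZero.ne N] using hj
  subst hv
  rw [map_zero, AddCircle.coe_zero, zero_add, ZMod.toAddCircle_eq_zero] at h
  rw [h]
  rfl

/-- The only use of the field: a finite subgroup of $\mathbb{F}^\times$ is cyclic, so
$H\cong\mathbb{Z}^n\times\mathbb{Z}/N$. -/
theorem exists_injective_addMonoidHom_of_fg {F : Type*} [Field F] (H : AddSubgroup (Additive Fˣ))
    [AddGroup.FG H] : ∃ ψ : H →+ UnitAddCircle, Function.Injective ψ := by
  classical
  obtain ⟨n, ι, _, p, hp, e, ⟨f⟩⟩ := AddCommGroup.equiv_free_prod_directSum_zmod H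
  have : ∀ i, NeZero (p i ^ e i) := fun i => ⟨pow_ne_zero _ (hp i).ne_zero⟩
  set T := DirectSum ι fun i => ZMod (p i ^ e i)
  have : Finite T := Finite.of_equiv _ (DirectSum.addEquivProd fun i => ZMod (p i ^ e i)).symm.toEquiv
  let g : T →+ Additive Fˣ := H.subtype.comp (f.symm.toAddMonoidHom.comp (AddMonoidHom.inr _ _))
  have hg : Function.Injective g := fun x y h => by
    have h' := f.symm.injective (Subtype.val_injective h)
    exact (Prod.mk.inj h').2
  let g' : Multiplicative T →* F := (Units.coeHom F).comp (AddMonoidHom.toMultiplicativeLeft g)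
  have hg' : Function.Injective g' := fun x y h => hg (Units.val_injective h)
  have hcyc : IsAddCyclic T :=
    isCyclic_multiplicative_iff.1 (isCyclic_of_injective_ringHom g' hg')
  let c := zmodAddCyclicAddEquiv hcyc
  have : NeZero (Nat.card T) := ⟨Nat.card_pos.ne'⟩
  obtain ⟨ψ, hψ⟩ := exists_injective_addMonoidHom_unitAddCircle n (Nat.card T)
  let c' := f.trans ((AddEquiv.refl (Fin n →₀ ℤ)).prodCongr c.symm)
  exact ⟨ψ.comp c'.toAddMonoidHom, hψ.comp c'.injective⟩

theorem exists_isSumOrdering_of_injective {G : Type*} [AddCommGroup G] {X : Set G}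
    (ψ : AddSubgroup.closure X →+ UnitAddCircle)
    (hψ : Function.Injective ψ) : ∃ pos : G → ℝ, IsSumOrdering X pos := by
  classical
  let E : UnitAddCircle → ℝ := fun z => AddCircle.equivIco 1 0 z
  have hE : ∀ z, ((E z : ℝ) : UnitAddCircle) = z := fun z => AddCircle.coe_equivIco
  have hE0 : ∀ z, 0 ≤ E z := fun z => (AddCircle.equivIco (1 : ℝ) 0 z).2.1
  have hE1 : ∀ z, E z < 1 := fun z => by simpa using (AddCircle.equivIco (1 : ℝ) 0 z).2.2
  let pos : G → ℝ := fun g => if h : g ∈ AddSubgroup.closure X then E (ψ ⟨g, h⟩) else 0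
  have hpos : ∀ {g} (hg : g ∈ X), pos g = E (ψ ⟨g, AddSubgroup.subset_closure hg⟩) :=
    fun hg => dif_pos (AddSubgroup.subset_closure hg)
  refine ⟨pos, fun u hu v hv huv => ?_, fun u hu v hv huv hlt => ?_⟩
  · rw [hpos hu, hpos hv] at huv
    have := congrArg (fun x : ℝ => (x : UnitAddCircle)) huv
    simp only [hE] at this
    exact congrArg Subtype.val (hψ this)
  · rw [hpos huv, hpos hv] at hlt
    rw [hpos huv, hpos hu]
    set a := ψ ⟨u, AddSubgroup.subset_closure hu⟩
    set b := ψ ⟨v, AddSubgroup.subset_closure hv⟩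
    have hc : ψ ⟨u + v, AddSubgroup.subset_closure huv⟩ = a + b := by
      rw [← map_add]; rfl
    rw [hc] at hlt ⊢
    have hz : ((E a + E b - E (a + b) : ℝ) : UnitAddCircle) = 0 := by
      rw [AddCircle.coe_sub, AddCircle.coe_add, hE, hE, hE, sub_self]
    -- The integer `n` is the carry. Dropping below $E(b)$ forces $n\ge 1$, and then $E(a+b)\le
    -- E(a)+E(b)-1<E(a)$.
    obtain ⟨n, hn⟩ := (AddCircle.coe_eq_zero_iff 1).1 hz
    rw [zsmul_one] at hn
    have hapos : 0 ≤ E a := hE0 a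
    have hb1 := hE1 b
    have hn1 : (0 : ℝ) < n := by linarith
    have hn2 : (1 : ℝ) ≤ n := by exact_mod_cast (Int.cast_pos.1 hn1 : 0 < n)
    linarith

theorem exists_isSumOrdering {F : Type*} [Field F] {X : Set (Additive Fˣ)} (hX : X.Finite) :
    ∃ pos : Additive Fˣ → ℝ, IsSumOrdering X pos := by
  have : AddGroup.FG (AddSubgroup.closure X) :=
    (AddGroup.fg_iff_addSubgroup_fg _).2 ((AddSubgroup.fg_iff _).2 ⟨X, rfl, hX⟩)
  obtain ⟨ψ, hψ⟩ := exists_injective_addMonoidHom_of_fg (AddSubgroup.closure X)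
  exact exists_isSumOrdering_of_injective ψ hψ

end Ordering

/-! ### Assembly -/

section Main

theorem lowerCentralSeries_le_iSup_gradedLCS {G K L : Type*} [AddCommGroup G] [CommRing K]
    [LieRing L] [LieAlgebra K L] {A : G → Submodule K L} (hA : ⨆ g, A g = ⊤) (n : ℕ) :
    (LieModule.lowerCentralSeries K L L n).toSubmodule ≤ ⨆ g, gradedLCS A A n g := by
  induction n with
  | zero => exact le_top.trans hA.ge
  | succ n ih =>
    rw [LieModule.lowerCentralSeries_succ, LieSubmodule.lieIdeal_oper_eq_linear_span',
      Submodule.span_le]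
    rintro _ ⟨x, -, y, hy, rfl⟩
    have hx : x ∈ ⨆ g, A g := hA ▸ Submodule.mem_top
    change ⁅x, y⁆ ∈ ⨆ g, gradedLCS A A (n + 1) g
    induction hx using Submodule.iSup_induction' with
    | mem u a ha =>
      have hy' := ih hy
      clear hy
      induction hy' using Submodule.iSup_induction' with
      | mem v b hb => exact Submodule.mem_iSup_of_mem (u + v) (lie_mem_gradedBracket ha hb)
      | zero => rw [lie_zero]; exact zero_mem _
      | add y z _ _ hy hz => rw [lie_add]; exact add_mem hy hz
    | zero => rw [zero_lie]; exact zero_mem _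
    | add y z _ _ hy hz => rw [add_lie]; exact add_mem hy hz

theorem exists_gradedLCS_eq_bot {F K L : Type*} [Field F] [CommRing K] [LieRing L] [LieAlgebra K L]
    {X : Set (Additive Fˣ)} (hX : IsArithmeticallyFree X) {A : Additive Fˣ → Submodule K L}
    (hA : IsGradedClosed A) (hAX : IsGradedSupported X A) :
    ∃ n ≤ arithDelta X ^ (2 ^ (X.ncard - 1) - 1), gradedLCS A A n = ⊥ := by
  obtain ⟨X, rfl⟩ := hX.1.exists_finset_coe
  rcases X.eq_empty_or_nonempty with rfl | hne
  · refine ⟨0, Nat.zero_le _, le_bot_iff.1 fun g x hx => ?_⟩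
    exact hAX hx (by simp)
  obtain ⟨hd1, hdle, hd⟩ := hX.arithDelta_spec hne
  rw [Set.ncard_coe_finset] at hdle ⊢
  generalize arithDelta (X : Set (Additive Fˣ)) = d at *
  obtain rfl | hd2 := hd1.eq_or_lt
  · exact ⟨1, by simp, gradedLCS_one_eq_bot hd hA hAX⟩
  have h4 : X.card = 2 ∨ X.card = 3 ∨ 4 ≤ X.card := by omega
  rcases h4 with h | h | h
  · exact ⟨2, by rw [h]; exact hd2.trans_eq (pow_one d).symm, gradedLCS_two_eq_bot hX h.le hA hAX⟩
  · refine ⟨3, ?_, gradedLCS_three_eq_bot hX h.le hA hAX⟩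
    rw [h]
    exact le_trans (by norm_num) (Nat.pow_le_pow_left hd2 (2 ^ (3 - 1) - 1))
  · obtain ⟨pos, hpos⟩ := exists_isSumOrdering hX.1
    exact exists_gradedLCS_eq_bot_of_four_le_card hX.zero_notMem hpos hd hd2 h hA hAX

end Main

theorem mainTheorem2 {F K L : Type*} [Field F] [DecidableEq (Additive Fˣ)]
    [CommRing K] [LieRing L] [LieAlgebra K L]
    (𝓛 : Additive Fˣ → Submodule K L) [GradedLieAlgebra 𝓛]
    (hX : IsArithmeticallyFree (gradingSupport 𝓛)) :
    LieRing.IsNilpotent L ∧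
      LieModule.nilpotencyLength L L ≤
        arithDelta (gradingSupport 𝓛) ^ (2 ^ ((gradingSupport 𝓛).ncard - 1) - 1) ∧
      arithDelta (gradingSupport 𝓛) ^ (2 ^ ((gradingSupport 𝓛).ncard - 1) - 1) ≤
        (gradingSupport 𝓛).ncard ^ (2 ^ ((gradingSupport 𝓛).ncard - 1) - 1) := by
  have hA : IsGradedClosed 𝓛 := fun _ _ _ _ ha hb => SetLike.GradedBracket.bracket_mem ha hb
  have hAX : IsGradedSupported (gradingSupport 𝓛) 𝓛 := fun g a ha hg =>
    (Submodule.mem_bot K).1 (not_not.1 hg ▸ ha)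
  obtain ⟨n, hn, h⟩ := exists_gradedLCS_eq_bot hX hA hAX
  have htop : ⨆ g, 𝓛 g = ⊤ := (DirectSum.Decomposition.isInternal 𝓛).submodule_iSup_eq_top
  have hbot : LieModule.lowerCentralSeries K L L n = ⊥ := by
    rw [← LieSubmodule.toSubmodule_eq_bot, ← le_bot_iff]
    refine (lowerCentralSeries_le_iSup_gradedLCS htop n).trans ?_
    rw [h]
    simp
  refine ⟨(LieModule.isNilpotent_iff K L L).2 ⟨n, hbot⟩, le_trans (Nat.sInf_le ?_) hn,
    Nat.pow_le_pow_left ?_ _⟩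
  -- The nilpotency length refers to the series over $\mathbb{Z}$, which has the same underlying
  -- sets.
  · have := LieModule.coe_lowerCentralSeries_eq_int K L L n
    rw [hbot] at this
    exact SetLike.ext' (by simpa using this.symm)
  · rcases (gradingSupport 𝓛).eq_empty_or_nonempty with hempty | hne
    -- For empty support no `d` qualifies, and the infimum takes its default value $0$.
    · have : {d : ℕ | 1 ≤ d ∧ d ≤ (gradingSupport 𝓛).ncard ∧
          SumsEscape (gradingSupport 𝓛) d} = ∅ := by
        rw [hempty, Set.ncard_empty]
        ext d
        simp only [Set.mem_ofPred_eq, Set.mem_empty_iff_false, iff_false]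
        omega
      exact (Nat.sInf_eq_zero.2 (Or.inr this)).le.trans (Nat.zero_le _)
    · exact (hX.arithDelta_spec hne).2.1
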